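/- Consider finite simple undirected graphs $G$ whose nodes are anonymous and whose edges at each node $v$ are labeled, arbitrarily and independently at the two ends, by distinct port numbers $0,1,\dots,\deg(v)-1$. A set of pebbles, at most one per node, is placed on $G$. An agent starts at a node $s$, with no prior knowledge of the graph, the treasure or the pebbles. At the start it perceives the degree of $s$ and whether $s$ holds a pebble; whenever it enters a node $v$ it perceives the degree of $v$, the port at $v$ through which it entered, and whether $v$ holds a pebble. A deterministic agent algorithm is a computable function that assigns to every finite sequence of perceptions the port by which the agent leaves its current node. The agent finds the treasure, located at a node $t$, when it reaches $t$; the time is the number of edges it has traversed by then. Theorem. There exist a single deterministic agent algorithm and an absolute constant $C$ such that the following holds for every such port-labeled graph $G$ of maximum degree $\Delta\ge 2$ and all nodes $s,t$ of $G$ with $t$ reachable from $s$, where $D=\operatorname{dist}(s,t)$. An oracle that knows $G$, its port labels, $s$ and $t$ can place at most $C\,D\log_2\Delta$ pebbles, at most one per node, so that the agent, starting at $s$ and following the algorithm, finds the treasure at $t$ in time at most $C\,(D\log_2\Delta+\log_2^3\Delta)$. -/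

import Mathlib

namespace TreasureHunt

universe u

/-- A port labeling of a graph: at every node `v` the incident edges carry the distinct labels
`0, 1, …, deg v - 1`; `nbr v p` is the neighbour of `v` at the other end of the edge with port `p`
at `v`. The labels given to an edge at its two ends are unrelated. -/
structure PortLabeling {V : Type u} (G : SimpleGraph V) [G.LocallyFinite] where
  nbr : ∀ v : V, Fin (G.degree v) ≃ G.neighborSet v

/-- What the agent perceives on arriving at a node: the port of the node through which it entered
(`none` at the start of the hunt), the degree of the node, and whether the node holds a pebble. -/
abbrev Observation : Type := Option ℕ × ℕ × Bool

/-- A deterministic strategy of the agent: the port by which to leave the current node, as a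
function of everything perceived so far (most recent observation first). -/
abbrev Strategy : Type := List Observation → ℕ

/-- The position of the agent, together with its observations so far (most recent first). -/
structure Config (V : Type u) where
  pos : V
  hist : List Observation

section Execution

variable {V : Type u} [DecidableEq V] {G : SimpleGraph V} [G.LocallyFinite]

/-- The observation made at `v` when it is entered through `entry`. -/
def observe (G : SimpleGraph V) [G.LocallyFinite] (pebbles : Finset V)
    (entry : Option ℕ) (v : V) : Observation :=
  (entry, G.degree v, decide (v ∈ pebbles))

/-- The agent at `s` before its first move. -/
def initial (G : SimpleGraph V) [G.LocallyFinite] (pebbles : Finset V) (s : V) : Config V :=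
  ⟨s, [observe G pebbles none s]⟩

/-- The label, at the far end `nbr v p`, of the edge with port `p` at `v`. -/
def PortLabeling.entryPort (L : PortLabeling G) (v : V) (p : Fin (G.degree v)) : ℕ :=
  ((L.nbr (L.nbr v p)).symm ⟨v, G.adj_symm (L.nbr v p).2⟩ : Fin _)

/-- One move: the agent traverses the edge with the port chosen by the strategy. The result is
`none` if the current node has no such port. -/
def step (L : PortLabeling G) (pebbles : Finset V) (A : Strategy) (c : Config V) :
    Option (Config V) :=
  if h : A c.hist < G.degree c.pos then
    let p : Fin (G.degree c.pos) := ⟨A c.hist, h⟩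
    let v : V := L.nbr c.pos p
    some ⟨v, observe G pebbles (some (L.entryPort c.pos p)) v :: c.hist⟩
  else none

/-- The configuration after `n` moves from `s` (`none` if a nonexistent port was chosen). -/
def run (L : PortLabeling G) (pebbles : Finset V) (A : Strategy) (s : V) : ℕ → Option (Config V)
  | 0 => some (initial G pebbles s)
  | n + 1 => (run L pebbles A s n).bind (step L pebbles A)

/-- The agent started at `s` stands at `t` after traversing exactly `n` edges. -/
def ReachesAfter (L : PortLabeling G) (pebbles : Finset V) (A : Strategy) (s t : V) (n : ℕ) :
    Prop :=
  ∃ c, run L pebbles A s n = some c ∧ c.pos = t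

end Execution

end TreasureHunt

/-! The agent walks along a shortest path `v 0, …, v D`; both pebbles and time come out as O(D log
Δ), without the cubic term. At a node that it reads, it probes the neighbours in port order, in
blocks of 12, ignoring the one it came from. A single pebble in the first nonempty block marks the
next node; this is cheap as long as degrees stay below a threshold T = O(log Δ). At a larger degree
the neighbours have room for a number: blocks with two or one pebbles are the binary digits 1 and 0,
empty blocks are skipped, and three pebbles end it. The leading digit 1 has two pebbles, so a number
is never mistaken for a mark. The number holds the ports of the next three moves in mixed radix, the
radices being the degrees met on the way, so it has O(log Δ) bits.

The difficulty is that a pebble may be seen from several path nodes. Nodes three or more apart on a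
shortest path share no neighbour, so after three blind moves the codeword is out of sight. To hide
it from the nodes before, let `v J` be the first node of degree at least T on the remaining path and
charge each of its first T neighbours to the first remaining path node adjacent to it. That node is
one of `v (J - 2)`, `v (J - 1)`, `v J`, so some `v e` is charged with a third of them, none visible
earlier (`Geodesic.exists_free`). So dense a set of ports has enough blocks with three free ports
(`card_usable`) for the codeword (`exists_codeword`). Nodes before `v e` use marks, and
`Geodesic.exists_pebbles` recurses from index `e + 3`. -/

namespace TreasureHunt

universe u

/-! ### The agent -/

/-- The memory of the agent `(mode, back, p, c, m, N, out)`, kept after each perception.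
In mode `0` the agent stands at the node that it reads and is about to probe the neighbour at
port `p`; in mode `1` it stands at that neighbour and is about to return; in mode `2` it leaves a
node for good. `back` is the port through which it entered the node that it reads, `c` the number of
pebbles found in the current block of ports, `m` the port of the last of them, `N` the number
decoded so far (mode `0` and `1`) or the route still to be followed (mode `2`), and `out` the port
to be taken next. -/
abbrev Memory : Type := ℕ × Option ℕ × ℕ × ℕ × ℕ × ℕ × ℕ

/-- The number of consecutive ports that carry one symbol. -/
abbrev blockSize : ℕ := 12

/-- The update of the memory at the end of a block, the next port being `p`. One pebble in the first
nonempty block marks the next node; otherwise one or two pebbles are a binary digit, and three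
pebbles end the number, which is then followed as a route in mixed radix. -/
def closeBlock (d : ℕ) (back : Option ℕ) (p c m N : ℕ) : Memory :=
  if c = 0 then (0, back, p, 0, 0, N, p)
  else if c = 1 then
    if N = 0 then (2, back, p, 0, 0, 1, m) else (0, back, p, 0, 0, 2 * N, p)
  else if c = 2 then (0, back, p, 0, 0, 2 * N + 1, p)
  else (2, back, p, 0, 0, N / d, N % d)

/-- The update of the memory by an observation. -/
def update (o : Observation) (x : Memory) : Memory :=
  match x with
  | (mode, back, p, c, m, N, _) =>
    if mode = 0 then
      (1, back, p, if o.2.2 = true ∧ back ≠ some p then c + 1 else c,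
        if o.2.2 = true ∧ back ≠ some p then p else m, N, o.1.getD 0)
    else if mode = 1 then
      if (p + 1) % blockSize = 0 ∨ o.2.1 ≤ p + 1 then closeBlock o.2.1 back (p + 1) c m N
      else (0, back, p + 1, c, m, N, p + 1)
    else if N = 1 then (0, o.1, 0, 0, 0, 0, 0)
    else (2, back, p, c, m, N / o.2.1, N % o.2.1)

/-- The memory before the first perception. -/
def blank : Memory := (2, none, 0, 0, 0, 1, 0)

/-- The memory after a sequence of perceptions. -/
def memory (h : List Observation) : Memory := h.foldr update blank

/-- The strategy of the agent. -/
def agent : Strategy := fun h => (memory h).2.2.2.2.2.2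

section Computability

open Primrec

theorem primrec_closeBlock {α : Type*} [Primcodable α] {d p c m N : α → ℕ} {b : α → Option ℕ}
    (hd : Primrec d) (hb : Primrec b) (hp : Primrec p) (hc : Primrec c) (hm : Primrec m)
    (hN : Primrec N) :
    Primrec fun x => closeBlock (d x) (b x) (p x) (c x) (m x) (N x) := by
  have h0 : Primrec fun _ : α => (0 : ℕ) := const 0
  have h2 : Primrec fun _ : α => (2 : ℕ) := const 2
  have hNN : Primrec fun x => 2 * N x := nat_mul.comp h2 hN
  have mk : ∀ {i n o : α → ℕ}, Primrec i → Primrec n → Primrec o →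
      Primrec fun x => ((i x, b x, p x, 0, 0, n x, o x) : Memory) := fun hi hn ho =>
    hi.pair (hb.pair (hp.pair (h0.pair (h0.pair (hn.pair ho)))))
  unfold closeBlock
  exact ite (Primrec.eq.comp hc h0) (mk h0 hN hp)
    (ite (Primrec.eq.comp hc (const 1))
      (ite (Primrec.eq.comp hN h0) (mk h2 (const 1) hm) (mk h0 hNN hp))
      (ite (Primrec.eq.comp hc h2) (mk h0 (succ.comp hNN) hp)
        (mk h2 (nat_div.comp hN hd) (nat_mod.comp hN hd))))

theorem primrec_update : Primrec₂ update := by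
  have o1 : Primrec fun x : Observation × Memory => x.1.1 := fst.comp fst
  have o2 : Primrec fun x : Observation × Memory => x.1.2.1 := fst.comp (snd.comp fst)
  have o3 : Primrec fun x : Observation × Memory => x.1.2.2 := snd.comp (snd.comp fst)
  have mode : Primrec fun x : Observation × Memory => x.2.1 := fst.comp snd
  have r1 : Primrec fun x : Observation × Memory => x.2.2 := snd.comp snd
  have back : Primrec fun x : Observation × Memory => x.2.2.1 := fst.comp r1
  have r2 : Primrec fun x : Observation × Memory => x.2.2.2 := snd.comp r1
  have p : Primrec fun x : Observation × Memory => x.2.2.2.1 := fst.comp r2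
  have r3 : Primrec fun x : Observation × Memory => x.2.2.2.2 := snd.comp r2
  have c : Primrec fun x : Observation × Memory => x.2.2.2.2.1 := fst.comp r3
  have r4 : Primrec fun x : Observation × Memory => x.2.2.2.2.2 := snd.comp r3
  have m : Primrec fun x : Observation × Memory => x.2.2.2.2.2.1 := fst.comp r4
  have r5 : Primrec fun x : Observation × Memory => x.2.2.2.2.2.2 := snd.comp r4
  have N : Primrec fun x : Observation × Memory => x.2.2.2.2.2.2.1 := fst.comp r5
  have h0 : Primrec fun _ : Observation × Memory => (0 : ℕ) := const 0
  have h1 : Primrec fun _ : Observation × Memory => (1 : ℕ) := const 1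
  have h2 : Primrec fun _ : Observation × Memory => (2 : ℕ) := const 2
  have p' := succ.comp p
  have seen : PrimrecPred fun x : Observation × Memory =>
      x.1.2.2 = true ∧ x.2.2.1 ≠ some x.2.2.2.1 :=
    (Primrec.eq.comp o3 (const true)).and (Primrec.eq.comp back (option_some.comp p)).not
  have done : PrimrecPred fun x : Observation × Memory =>
      (x.2.2.2.1 + 1) % blockSize = 0 ∨ x.1.2.1 ≤ x.2.2.2.1 + 1 :=
    (Primrec.eq.comp (nat_mod.comp p' (const blockSize)) h0).or (nat_le.comp o2 p')
  refine Primrec.of_eq (ite (Primrec.eq.comp mode h0)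
    (h1.pair (back.pair (p.pair ((ite seen (succ.comp c) c).pair
      ((ite seen p m).pair (N.pair (option_getD.comp o1 h0)))))))
    (ite (Primrec.eq.comp mode h1)
      (ite done (primrec_closeBlock o2 back p' c m N)
        (h0.pair (back.pair (p'.pair (c.pair (m.pair (N.pair p')))))))
      (ite (Primrec.eq.comp N h1)
        (h0.pair (o1.pair (h0.pair (h0.pair (h0.pair (h0.pair h0))))))
        (h2.pair (back.pair (p.pair (c.pair (m.pair
          ((nat_div.comp N o2).pair (nat_mod.comp N o2))))))))))
    (fun x => rfl)

/-- The memory is a fold of a primitive recursive update over the perceptions, so the agent is even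
primitive recursive. -/
theorem computable_agent : Computable agent := by
  have hm : Primrec memory :=
    list_foldr Primrec.id (const blank) (primrec_update.comp (fst.comp snd) (snd.comp snd)).to₂
  exact (snd.comp (snd.comp (snd.comp (snd.comp (snd.comp (snd.comp hm)))))).to_comp

end Computability

/-! ### Executions of the agent -/

section Execution

variable {V : Type u} {G : SimpleGraph V} [G.LocallyFinite]

/-- The port at `v` of the edge from `v` to `u`. -/
def PortLabeling.port (L : PortLabeling G) {v u : V} (h : G.Adj v u) : ℕ :=
  ((L.nbr v).symm ⟨u, h⟩ : Fin _)

theorem PortLabeling.port_lt (L : PortLabeling G) {v u : V} (h : G.Adj v u) :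
    L.port h < G.degree v := ((L.nbr v).symm ⟨u, h⟩).2

theorem PortLabeling.port_injective (L : PortLabeling G) {v u w : V} (h : G.Adj v u)
    (h' : G.Adj v w) (e : L.port h = L.port h') : u = w := by
  have := (L.nbr v).symm.injective (Fin.ext e)
  exact congrArg Subtype.val this

theorem PortLabeling.exists_port (L : PortLabeling G) {v : V} {p : ℕ} (hp : p < G.degree v) :
    ∃ (u : V) (h : G.Adj v u), L.port h = p :=
  ⟨L.nbr v ⟨p, hp⟩, (L.nbr v ⟨p, hp⟩).2, by simp [PortLabeling.port]⟩

variable [DecidableEq V]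

/-- After `k` moves the agent stands at `v` with memory `x`. -/
def At (L : PortLabeling G) (P : Finset V) (s : V) (k : ℕ) (v : V) (x : Memory) : Prop :=
  ∃ c, run L P agent s k = some c ∧ c.pos = v ∧ memory c.hist = x

variable {L : PortLabeling G} {P : Finset V} {s : V}

/-- The blank memory is that of a route with no moves left, so the first perception makes the agent
start reading `s`. -/
theorem At.zero : At L P s 0 s (0, none, 0, 0, 0, 0, 0) :=
  ⟨_, rfl, rfl, rfl⟩

theorem At.reaches {k : ℕ} {v : V} {x : Memory} (h : At L P s k v x) :
    ReachesAfter L P agent s v k := by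
  obtain ⟨c, h1, h2, -⟩ := h
  exact ⟨c, h1, h2⟩

theorem At.step {k : ℕ} {v u : V} {x : Memory} (hx : At L P s k v x) (h : G.Adj v u)
    (hout : x.2.2.2.2.2.2 = L.port h) :
    At L P s (k + 1) u (update (some (L.port h.symm), G.degree u, decide (u ∈ P)) x) := by
  obtain ⟨⟨w, hist⟩, h1, rfl, rfl⟩ := hx
  have ha : agent hist = L.port h := hout
  have hlt : agent hist < G.degree w := ha ▸ L.port_lt h
  have hn : L.nbr w ⟨agent hist, hlt⟩ = ⟨u, h⟩ := by
    have : (⟨agent hist, hlt⟩ : Fin (G.degree w)) = (L.nbr w).symm ⟨u, h⟩ := Fin.ext ha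
    rw [this, Equiv.apply_symm_apply]
  refine ⟨⟨u, (some (L.port h.symm), G.degree u, decide (u ∈ P)) :: hist⟩, ?_, rfl, rfl⟩
  rw [run, h1]
  simp only [Option.bind_some, TreasureHunt.step, dif_pos hlt, Option.some.injEq]
  -- The type of the entry port depends on the node reached, so the neighbour is generalized before
  -- it is substituted.
  have key : ∀ y : G.neighborSet w, y = ⟨u, h⟩ →
      (⟨y.1, observe G P (some ((L.nbr y.1).symm ⟨w, G.adj_symm y.2⟩ : Fin _).1) y.1 :: hist⟩ :
        Config V) = ⟨u, (some (L.port h.symm), G.degree u, decide (u ∈ P)) :: hist⟩ := by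
    rintro _ rfl
    rfl
  exact key _ hn

/-- Whether the neighbour at a port, not the one of arrival, holds a pebble. -/
def Pebbled (L : PortLabeling G) (P : Finset V) (v : V) (back : Option ℕ) (p : ℕ) : Prop :=
  back ≠ some p ∧ ∃ (u : V) (h : G.Adj v u), L.port h = p ∧ u ∈ P

/-- Probing the neighbour at one port. -/
theorem At.probe {k : ℕ} {v : V} {b : Option ℕ} {p c m N : ℕ} [DecidablePred (Pebbled L P v b)]
    (hx : At L P s k v (0, b, p, c, m, N, p)) (hp : p < G.degree v) :
    At L P s (k + 2) v
      (if (p + 1) % blockSize = 0 ∨ G.degree v ≤ p + 1 then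
        closeBlock (G.degree v) b (p + 1) (if Pebbled L P v b p then c + 1 else c)
          (if Pebbled L P v b p then p else m) N
      else (0, b, p + 1, (if Pebbled L P v b p then c + 1 else c),
          (if Pebbled L P v b p then p else m), N, p + 1)) := by
  obtain ⟨u, h, hu⟩ := L.exists_port hp
  have h1 := hx.step h hu.symm
  have h2 := h1.step h.symm (by simp [update])
  have e : (decide (u ∈ P) = true ∧ b ≠ some p) ↔ Pebbled L P v b p := by
    rw [decide_eq_true_iff]
    constructor
    · rintro ⟨h1, h2⟩
      exact ⟨h2, u, h, hu, h1⟩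
    · rintro ⟨h2, w, hw, e, h1⟩
      exact ⟨L.port_injective h hw (hu.trans e.symm) ▸ h1, h2⟩
  simpa only [update, e, if_true, one_ne_zero, if_false] using h2

end Execution

/-! ### Reading a node -/

/-- The ports of the block with index `q`. -/
def block (q : ℕ) : Finset ℕ := Finset.Ico (blockSize * q) (blockSize * q + blockSize)

theorem mem_block {p q : ℕ} : p ∈ block q ↔ p / blockSize = q := by
  simp only [block, blockSize, Finset.mem_Ico]
  omega

/-- The effect of a block with `c` pebbles on the number decoded so far. -/
def Digit (c n n' : ℕ) : Prop :=
  (c = 0 ∧ n' = n) ∨ (c = 1 ∧ n ≠ 0 ∧ n' = 2 * n) ∨ (c = 2 ∧ n' = 2 * n + 1)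

section Reading

variable {V : Type u} [DecidableEq V] {G : SimpleGraph V} [G.LocallyFinite]
variable {L : PortLabeling G} {P : Finset V} {s : V}

/-- This covers the ports of a block before its last one, where `closeBlock` is not yet triggered.
-/
theorem At.scan {k : ℕ} {v : V} {b : Option ℕ} {N q : ℕ} {S : Finset ℕ}
    (hS : ∀ p, Pebbled L P v b p ↔ p ∈ S)
    (hx : At L P s k v (0, b, blockSize * q, 0, 0, N, blockSize * q)) (j : ℕ) (hj : j < blockSize)
    (hd : blockSize * q + j < G.degree v) :
    ∃ m, ((S ∩ Finset.Ico (blockSize * q) (blockSize * q + j)).card ≠ 0 → m ∈ S) ∧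
      At L P s (k + 2 * j) v (0, b, blockSize * q + j,
        (S ∩ Finset.Ico (blockSize * q) (blockSize * q + j)).card, m, N, blockSize * q + j) := by
  classical
  induction j with
  | zero => exact ⟨0, by simp, by simpa using hx⟩
  | succ j ih =>
    obtain ⟨m, hm, h⟩ := ih (by omega) (by omega)
    have h' := h.probe (by omega)
    rw [if_neg (by simp only [blockSize] at *; omega)] at h'
    simp only [hS] at h'
    rw [← add_assoc (blockSize * q) j 1, ← Order.succ_eq_add_one (blockSize * q + j),
      ← Finset.insert_Ico_right_eq_Ico_succ (by omega)]
    by_cases hp : blockSize * q + j ∈ S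
    · rw [Finset.inter_insert_of_mem hp, Finset.card_insert_of_notMem (by simp)]
      simp only [hp, if_true] at h'
      exact ⟨_, fun _ => hp, h'⟩
    · rw [Finset.inter_insert_of_notMem hp]
      simp only [hp, if_false] at h'
      exact ⟨_, hm, h'⟩

theorem At.readBlock {k : ℕ} {v : V} {b : Option ℕ} {N q : ℕ} {S : Finset ℕ}
    (hS : ∀ p, Pebbled L P v b p ↔ p ∈ S)
    (hx : At L P s k v (0, b, blockSize * q, 0, 0, N, blockSize * q))
    (hd : blockSize * q < G.degree v) :
    ∃ m, ((S ∩ block q).card ≠ 0 → m ∈ S) ∧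
      At L P s (k + 2 * (min (blockSize * (q + 1)) (G.degree v) - blockSize * q)) v
        (closeBlock (G.degree v) b (min (blockSize * (q + 1)) (G.degree v))
          (S ∩ block q).card m N) := by
  classical
  -- The degree may cut the block short; it has `j + 1` ports, and the last of them is probed
  -- separately since it closes the block.
  obtain ⟨j, hj⟩ : ∃ j, min (blockSize * (q + 1)) (G.degree v) = blockSize * q + j + 1 :=
    ⟨min (blockSize * (q + 1)) (G.degree v) - blockSize * q - 1, by
      simp only [blockSize] at *; omega⟩
  have hj' : j < blockSize ∧ blockSize * q + j < G.degree v ∧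
      ((blockSize * q + j + 1) % blockSize = 0 ∨ G.degree v ≤ blockSize * q + j + 1) := by
    simp only [blockSize] at *
    omega
  obtain ⟨m, hm, h⟩ := hx.scan hS j hj'.1 hj'.2.1
  have h' := h.probe hj'.2.1
  rw [if_pos hj'.2.2] at h'
  simp only [hS] at h'
  have hlt : ∀ p ∈ S, p < G.degree v := by
    intro p hp
    obtain ⟨-, u, hu, rfl, -⟩ := (hS p).2 hp
    exact L.port_lt hu
  have hB : S ∩ block q = S ∩ insert (blockSize * q + j)
      (Finset.Ico (blockSize * q) (blockSize * q + j)) := by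
    ext p
    simp only [block, Finset.mem_inter, Finset.mem_insert, Finset.mem_Ico]
    refine and_congr_right fun hp => ?_
    have := hlt p hp
    simp only [blockSize] at *
    omega
  rw [hB, hj]
  have ht : k + 2 * (blockSize * q + j + 1 - blockSize * q) = k + 2 * j + 2 := by omega
  rw [ht]
  by_cases hp : blockSize * q + j ∈ S
  · rw [Finset.inter_insert_of_mem hp, Finset.card_insert_of_notMem (by simp)]
    simp only [hp, if_true] at h'
    exact ⟨_, fun _ => hp, h'⟩
  · rw [Finset.inter_insert_of_notMem hp]
    simp only [hp, if_false] at h'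
    exact ⟨_, hm, h'⟩

theorem At.readDigits {k : ℕ} {v : V} {b : Option ℕ} {S : Finset ℕ}
    (hS : ∀ p, Pebbled L P v b p ↔ p ∈ S) (hx : At L P s k v (0, b, 0, 0, 0, 0, 0))
    {n : ℕ → ℕ} (hn : n 0 = 0) (r : ℕ)
    (hD : ∀ q < r, Digit (S ∩ block q).card (n q) (n (q + 1)))
    (hr : blockSize * r < G.degree v) :
    At L P s (k + 2 * blockSize * r) v (0, b, blockSize * r, 0, 0, n r, blockSize * r) := by
  induction r with
  | zero => simpa [hn] using hx
  | succ r ih =>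
    have h1 := ih (fun q hq => hD q (by omega)) (by simp only [blockSize] at *; omega)
    obtain ⟨m, -, h2⟩ := h1.readBlock hS (by simp only [blockSize] at *; omega)
    rw [min_eq_left hr.le] at h2
    have ht : k + 2 * blockSize * r + 2 * (blockSize * (r + 1) - blockSize * r) =
        k + 2 * blockSize * (r + 1) := by simp only [blockSize]; omega
    rw [ht] at h2
    rcases hD r (by omega) with ⟨hc, e⟩ | ⟨hc, h0, e⟩ | ⟨hc, e⟩ <;>
      simpa [hc, e, closeBlock, *] using h2

/-- Reading a node of which only the neighbour at port `p` holds a pebble. -/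
theorem At.readMark {k : ℕ} {v : V} {b : Option ℕ} {p : ℕ}
    (hS : ∀ p', Pebbled L P v b p' ↔ p' = p) (hx : At L P s k v (0, b, 0, 0, 0, 0, 0))
    (hp : p < G.degree v) :
    ∃ k' ≤ k + 2 * G.degree v, ∃ b' p' c' m', At L P s k' v (2, b', p', c', m', 1, p) := by
  have hS' : ∀ p', Pebbled L P v b p' ↔ p' ∈ ({p} : Finset ℕ) := by simpa using hS
  -- The blocks before that of `p` are empty, so the decoded number is still `0` when the single
  -- pebble is met.
  have h1 := hx.readDigits hS' (n := fun _ => 0) rfl (p / blockSize) (by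
    intro q hq
    left
    rw [Finset.singleton_inter_of_notMem (by rw [mem_block]; omega)]
    simp) (by simp only [blockSize] at *; omega)
  obtain ⟨m, hm, h2⟩ := h1.readBlock hS' (by simp only [blockSize] at *; omega)
  rw [Finset.singleton_inter_of_mem (by rw [mem_block])] at h2 hm
  have hmp : m = p := by simpa using hm (by simp)
  subst hmp
  refine ⟨_, ?_, _, _, _, _, by simpa [closeBlock] using h2⟩
  simp only [blockSize] at *
  omega

/-- Reading a node whose neighbours carry a number. -/
theorem At.readNumber {k : ℕ} {v : V} {b : Option ℕ} {S : Finset ℕ}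
    (hS : ∀ p, Pebbled L P v b p ↔ p ∈ S) (hx : At L P s k v (0, b, 0, 0, 0, 0, 0))
    {n : ℕ → ℕ} (hn : n 0 = 0) {r : ℕ}
    (hD : ∀ q < r, Digit (S ∩ block q).card (n q) (n (q + 1)))
    (hr : (S ∩ block r).card = 3) :
    ∃ k' ≤ k + 2 * (blockSize * (r + 1)), ∃ b' p' c' m',
      At L P s k' v (2, b', p', c', m', n r / G.degree v, n r % G.degree v) := by
  have hd : blockSize * r < G.degree v := by
    obtain ⟨p, hp⟩ := Finset.card_pos.1 (by omega : 0 < (S ∩ block r).card)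
    obtain ⟨hp, hb⟩ := Finset.mem_inter.1 hp
    obtain ⟨-, u, hu, rfl, -⟩ := (hS p).2 hp
    have := L.port_lt hu
    rw [mem_block] at hb
    simp only [blockSize] at *
    omega
  have h1 := hx.readDigits hS hn r hD hd
  obtain ⟨m, -, h2⟩ := h1.readBlock hS hd
  rw [hr] at h2
  refine ⟨_, ?_, _, _, _, _, by simpa [closeBlock] using h2⟩
  simp only [blockSize] at *
  omega

end Reading

/-! ### Writing a number into free ports -/

theorem union_inter_block_of_lt {S A : Finset ℕ} {q K : ℕ} (hq : q < K) (hA : A ⊆ block K) :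
    (S ∪ A) ∩ block q = S ∩ block q := by
  ext p
  simp only [Finset.mem_inter, Finset.mem_union]
  constructor
  · rintro ⟨hp | hp, hb⟩
    · exact ⟨hp, hb⟩
    · have := mem_block.1 (hA hp)
      rw [mem_block] at hb
      omega
  · rintro ⟨hp, hb⟩
    exact ⟨Or.inl hp, hb⟩

theorem union_inter_block_self {S A : Finset ℕ} {K : ℕ} (hS : ∀ p ∈ S, p < blockSize * K)
    (hA : A ⊆ block K) : (S ∪ A) ∩ block K = A := by
  ext p
  simp only [Finset.mem_inter, Finset.mem_union]
  constructor
  · rintro ⟨hp | hp, hb⟩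
    · have := hS p hp
      rw [mem_block] at hb
      simp only [blockSize] at *
      omega
    · exact hp
  · exact fun hp => ⟨Or.inr hp, hA hp⟩

/-- The last binary digit of `N` goes into the last usable block and `N / 2` into the earlier ones;
unusable blocks stay empty. Once the number is exhausted, the remaining blocks stay empty too, so
there are no leading zeros. -/
theorem exists_digits (F : Finset ℕ) (K N : ℕ)
    (h : N.size ≤ ((Finset.range K).filter fun q => 3 ≤ (F ∩ block q).card).card) :
    ∃ S ⊆ F, (∀ p ∈ S, p < blockSize * K) ∧ ∃ n : ℕ → ℕ, n 0 = 0 ∧ n K = N ∧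
      ∀ q < K, Digit (S ∩ block q).card (n q) (n (q + 1)) := by
  induction K generalizing N with
  | zero =>
    have : N = 0 := by simpa [Nat.size_eq_zero] using h
    exact ⟨∅, by simp, by simp, fun _ => 0, rfl, this.symm, by simp⟩
  | succ K ih =>
    have extend : ∀ N' A, N'.size ≤
        ((Finset.range K).filter fun q => 3 ≤ (F ∩ block q).card).card → A ⊆ F ∩ block K →
        Digit A.card N' N → ∃ S ⊆ F, (∀ p ∈ S, p < blockSize * (K + 1)) ∧ ∃ n : ℕ → ℕ, n 0 = 0 ∧
          n (K + 1) = N ∧ ∀ q < K + 1, Digit (S ∩ block q).card (n q) (n (q + 1)) := by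
      intro N' A hN' hA hD
      obtain ⟨S, hSF, hSK, n, hn0, hnK, hn⟩ := ih N' hN'
      refine ⟨S ∪ A, Finset.union_subset hSF (hA.trans Finset.inter_subset_left), ?_,
        fun q => if q ≤ K then n q else N, by simp [hn0], by simp, ?_⟩
      · intro p hp
        rcases Finset.mem_union.1 hp with hp | hp
        · have := hSK p hp
          simp only [blockSize] at *
          omega
        · have := mem_block.1 (Finset.mem_inter.1 (hA hp)).2
          simp only [blockSize] at *
          omega
      · intro q hq
        rcases Nat.lt_succ_iff_lt_or_eq.1 hq with hq | rfl
        · have e := union_inter_block_of_lt (S := S) hq (hA.trans Finset.inter_subset_right)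
          simp only [e, if_pos hq.le, if_pos (Nat.succ_le_of_lt hq)]
          exact hn q hq
        · have e := union_inter_block_self hSK (hA.trans Finset.inter_subset_right)
          simpa [e, hnK] using hD
    rw [Finset.range_add_one, Finset.filter_insert] at h
    by_cases hu : 3 ≤ (F ∩ block K).card
    · rw [if_pos hu, Finset.card_insert_of_notMem (by simp)] at h
      rcases Nat.eq_zero_or_pos N with rfl | hN
      · exact extend 0 ∅ (by simp) (by simp) (by simp [Digit])
      · have hs : (N / 2).size + 1 ≤ N.size := by
          rw [Nat.succ_le_iff, Nat.lt_size]
          rcases Nat.eq_zero_or_pos (N / 2) with h0 | h0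
          · simp [h0]; omega
          · obtain ⟨j, hj⟩ := Nat.exists_eq_succ_of_ne_zero (Nat.size_pos.2 h0).ne'
            have : 2 ^ j ≤ N / 2 := Nat.lt_size.1 (by omega)
            rw [hj, Nat.pow_succ]
            omega
        obtain ⟨A, hA, hc⟩ := Finset.exists_subset_card_eq
          (show N % 2 + 1 ≤ (F ∩ block K).card by omega)
        refine extend (N / 2) A (by omega) hA ?_
        rw [hc, Digit]
        rcases Nat.mod_two_eq_zero_or_one N with h2 | h2
        · exact Or.inr (Or.inl ⟨by omega, by omega, by omega⟩)
        · exact Or.inr (Or.inr ⟨by omega, by omega⟩)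
    · rw [if_neg hu] at h
      exact extend N ∅ h (by simp) (by simp [Digit])

/-- A number can be written, followed by a terminating block, into free ports. -/
theorem exists_codeword (F : Finset ℕ) (K N : ℕ)
    (h : N.size < ((Finset.range K).filter fun q => 3 ≤ (F ∩ block q).card).card) :
    ∃ S ⊆ F, ∃ r < K, ∃ n : ℕ → ℕ, n 0 = 0 ∧ n r = N ∧
      (∀ q < r, Digit (S ∩ block q).card (n q) (n (q + 1))) ∧ (S ∩ block r).card = 3 := by
  induction K with
  | zero => simp at h
  | succ K ih =>
    rw [Finset.range_add_one, Finset.filter_insert] at h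
    by_cases hu : 3 ≤ (F ∩ block K).card
    · rw [if_pos hu, Finset.card_insert_of_notMem (by simp)] at h
      obtain ⟨S, hSF, hSK, n, hn0, hnK, hn⟩ := exists_digits F K N (by omega)
      obtain ⟨A, hA, hc⟩ := Finset.exists_subset_card_eq hu
      refine ⟨S ∪ A, Finset.union_subset hSF (hA.trans Finset.inter_subset_left), K, by omega, n,
        hn0, hnK, fun q hq => ?_, ?_⟩
      · have e := union_inter_block_of_lt (S := S) hq (hA.trans Finset.inter_subset_right)
        rw [e]
        exact hn q hq
      · have e := union_inter_block_self hSK (hA.trans Finset.inter_subset_right)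
        rw [e, hc]
    · rw [if_neg hu] at h
      obtain ⟨S, hS, r, hr, h'⟩ := ih h
      exact ⟨S, hS, r, by omega, h'⟩

/-- Dense sets of ports contain many usable blocks. -/
theorem card_usable (F : Finset ℕ) (K : ℕ) (hF : ∀ p ∈ F, p < blockSize * K) :
    F.card ≤ 10 * ((Finset.range K).filter fun q => 3 ≤ (F ∩ block q).card).card + 2 * K := by
  have h1 : F.card = ∑ q ∈ Finset.range K, (F ∩ block q).card := by
    rw [Finset.card_eq_sum_card_fiberwise (f := fun p => p / blockSize) (t := Finset.range K)]
    · refine Finset.sum_congr rfl fun q _ => congrArg _ ?_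
      ext p
      simp [mem_block]
    · intro p hp
      have := hF p hp
      simp only [blockSize, Finset.coe_range, Set.mem_Iio] at *
      omega
  -- A usable block contributes at most 12 = 10 + 2 ports, any other block at most 2.
  have h2 : ∀ q ∈ Finset.range K, (F ∩ block q).card ≤
      10 * (if 3 ≤ (F ∩ block q).card then 1 else 0) + 2 := by
    intro q _
    have h3 : (F ∩ block q).card ≤ 12 :=
      (Finset.card_le_card Finset.inter_subset_right).trans (by simp [block])
    split_ifs <;> omega
  rw [h1]
  refine (Finset.sum_le_sum h2).trans ?_
  rw [Finset.sum_add_distrib, ← Finset.mul_sum, Finset.card_filter]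
  simp [mul_comm]

/-! ### Following a shortest path -/

/-- The properties of a shortest path `v 0, …, v D` that are used below. -/
structure Geodesic {V : Type u} (G : SimpleGraph V) (D : ℕ) (v : ℕ → V) : Prop where
  adj : ∀ i < D, G.Adj (v i) (v (i + 1))
  ne : ∀ i, i + 2 ≤ D → v i ≠ v (i + 2)
  not_adj : ∀ i j, i + 2 ≤ j → j ≤ D → ¬ G.Adj (v i) (v j)
  not_common : ∀ i j u, i + 3 ≤ j → j ≤ D → G.Adj (v i) u → ¬ G.Adj (v j) u

/-- Replacing the piece between two indices by another walk cannot shorten a shortest path; the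
fields follow from replacements of length 0, 1 and 2. -/
theorem Geodesic.of_walk {V : Type u} {G : SimpleGraph V} {s t : V} (w : G.Walk s t)
    (hw : w.length = G.dist s t) : Geodesic G w.length w.getVert := by
  have key : ∀ i j (q : G.Walk (w.getVert i) (w.getVert j)), i ≤ j → j ≤ w.length →
      j ≤ i + q.length := by
    intro i j q hij hj
    have h := G.dist_le (((w.take i).append q).append (w.drop j))
    simp only [SimpleGraph.Walk.length_append, SimpleGraph.Walk.take_length,
      SimpleGraph.Walk.drop_length] at h
    omega
  refine ⟨fun i hi => w.adj_getVert_succ hi, fun i hi h => ?_, fun i j hij hj h => ?_,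
    fun i j u hij hj h h' => ?_⟩
  · have := key i (i + 2) (SimpleGraph.Walk.nil.copy rfl h) (by omega) hi
    simp at this
  · have := key i j h.toWalk (by omega) hj
    simp at this
    omega
  · have := key i j (SimpleGraph.Walk.cons h h'.symm.toWalk) (by omega) hj
    simp at this
    omega

/-- The number that encodes, in the mixed radix `d`, the ports `p` of the `r` moves from index
`i` on. -/
def route (d p : ℕ → ℕ) (i : ℕ) : ℕ → ℕ
  | 0 => 1
  | r + 1 => p i + d i * route d p (i + 1) r

theorem route_pos {d p : ℕ → ℕ} (hd : ∀ i, 0 < d i) (i r : ℕ) : 0 < route d p i r := by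
  induction r generalizing i with
  | zero => simp [route]
  | succ r ih => exact Nat.add_pos_right _ (Nat.mul_pos (hd i) (ih _))

theorem route_le {d p : ℕ → ℕ} {m : ℕ} (hd : ∀ i, 0 < d i) (hm : ∀ i, d i ≤ m)
    (hp : ∀ i, p i ≤ m) (i r : ℕ) : route d p i r ≤ (2 * m) ^ r := by
  induction r generalizing i with
  | zero => simp [route]
  | succ r ih =>
    have h1 : 1 ≤ (2 * m) ^ r := (route_pos hd (i + 1) r).trans_le (ih (i + 1))
    have h2 : d i * route d p (i + 1) r ≤ m * (2 * m) ^ r := Nat.mul_le_mul (hm i) (ih _)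
    calc route d p i (r + 1) ≤ m * 1 + m * (2 * m) ^ r := by
          rw [route, mul_one]; exact add_le_add (hp i) h2
      _ ≤ m * (2 * m) ^ r + m * (2 * m) ^ r := by gcongr
      _ = (2 * m) ^ (r + 1) := by ring

section Following

variable {V : Type u} {G : SimpleGraph V} [G.LocallyFinite]

open Classical in
/-- The port at `v` of the edge from `v` to `u`, and `0` if there is no such edge. -/
noncomputable def PortLabeling.portTo (L : PortLabeling G) (v u : V) : ℕ :=
  if h : G.Adj v u then L.port h else 0

theorem PortLabeling.portTo_eq (L : PortLabeling G) {v u : V} (h : G.Adj v u) :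
    L.portTo v u = L.port h := dif_pos h

theorem Geodesic.two_le_degree {v : ℕ → V} {D : ℕ} (hv : Geodesic G D v)
    (L : PortLabeling G) {i : ℕ} (hi : i + 2 ≤ D) : 2 ≤ G.degree (v (i + 1)) := by
  have h1 := (hv.adj i (by omega)).symm
  have h2 := hv.adj (i + 1) (by omega)
  have h3 := L.port_lt h1
  have h4 := L.port_lt h2
  have h5 : L.port h1 ≠ L.port h2 := fun e => hv.ne i hi (L.port_injective h1 h2 e)
  omega

/-- The node `u` precedes the node with index `i`. -/
def IsPrev (v : ℕ → V) (i : ℕ) (u : V) : Prop := ∃ j, j + 1 = i ∧ u = v j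

variable [DecidableEq V]

/-- After `k` moves the agent stands at the node with index `i`, reached from its predecessor, and is
about to read it. -/
def Ready (L : PortLabeling G) (P : Finset V) (v : ℕ → V) (k i : ℕ) : Prop :=
  ∃ b, At L P (v 0) k (v i) (0, b, 0, 0, 0, 0, 0) ∧
    ∀ (u : V) (h : G.Adj (v i) u), b = some (L.port h) ↔ IsPrev v i u

variable {L : PortLabeling G} {P : Finset V} {v : ℕ → V} {D : ℕ}

theorem Ready.zero : Ready L P v 0 0 :=
  ⟨none, At.zero, by simp [IsPrev]⟩

theorem ready_of_adj {k i : ℕ} (h : G.Adj (v i) (v (i + 1)))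
    (hx : At L P (v 0) k (v (i + 1)) (0, some (L.port h.symm), 0, 0, 0, 0, 0)) :
    Ready L P v k (i + 1) := by
  refine ⟨_, hx, fun u hu => ?_⟩
  rw [Option.some.injEq]
  constructor
  · exact fun e => ⟨i, rfl, (L.port_injective _ _ e).symm⟩
  · rintro ⟨j, hj, rfl⟩
    obtain rfl : j = i := by omega
    rfl

/-- The agent follows a route. -/
theorem Geodesic.follow (hv : Geodesic G D v) {d p : ℕ → ℕ} (hd : ∀ i, d i = G.degree (v i))
    (hp : ∀ i, p i = L.portTo (v i) (v (i + 1))) (hd0 : ∀ i, 0 < d i)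
    {k i r : ℕ} (hi : i < D) {b : Option ℕ} {q c m : ℕ}
    (hx : At L P (v 0) k (v i) (2, b, q, c, m, route d p (i + 1) r, p i)) :
    ∃ k' ≤ k + (r + 1), (∃ x, At L P (v 0) k' (v D) x) ∨
      (i + 1 + r ≤ D ∧ Ready L P v k' (i + 1 + r)) := by
  induction r generalizing k i b q c m with
  | zero =>
    have h := hx.step (hv.adj i hi) (by simp [hp, L.portTo_eq (hv.adj i hi)])
    exact ⟨k + 1, le_rfl, Or.inr ⟨hi, ready_of_adj (hv.adj i hi) (by simpa [update, route] using h)⟩⟩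
  | succ r ih =>
    have h := hx.step (hv.adj i hi) (by simp [hp, L.portTo_eq (hv.adj i hi)])
    -- If the path ends here, the treasure is reached and the rest of the route does not matter.
    rcases Nat.eq_or_lt_of_le (Nat.succ_le_of_lt hi) with rfl | hi'
    · exact ⟨k + 1, by omega, Or.inl ⟨_, h⟩⟩
    · have h2 : 2 ≤ d (i + 1) := (hd _).symm ▸ hv.two_le_degree L hi'
      have hpd : p (i + 1) < d (i + 1) := by
        rw [hp, hd, L.portTo_eq (hv.adj (i + 1) hi')]
        exact L.port_lt _
      -- Inner nodes of the path have degree at least 2, so an unfinished route is never `1`, the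
      -- end marker.
      have hne : route d p (i + 1) (r + 1) ≠ 1 := by
        have := Nat.mul_le_mul h2 (route_pos (p := p) hd0 (i + 1 + 1) r)
        rw [route]
        omega
      have hdiv : route d p (i + 1) (r + 1) / d (i + 1) = route d p (i + 1 + 1) r := by
        rw [route, Nat.add_mul_div_left _ _ (by omega), Nat.div_eq_of_lt hpd, zero_add]
      have hmod : route d p (i + 1) (r + 1) % d (i + 1) = p (i + 1) := by
        rw [route, Nat.add_mul_mod_self_left, Nat.mod_eq_of_lt hpd]
      simp only [update, hne, ← hd, hdiv, hmod] at h
      obtain ⟨k', hk', h'⟩ := ih hi' h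
      refine ⟨k', by omega, h'.imp id ?_⟩
      rintro ⟨h1, h3⟩
      exact ⟨by omega, by rwa [show i + 1 + (r + 1) = i + 1 + 1 + r by omega]⟩

/-- The agent moves on from a node among whose neighbours the next node is marked. -/
theorem Geodesic.mark (hv : Geodesic G D v) {k i : ℕ} (hi : i < D) (hx : Ready L P v k i)
    (hP : ∀ u, G.Adj (v i) u → ¬ IsPrev v i u → (u ∈ P ↔ u = v (i + 1))) :
    ∃ k' ≤ k + (2 * G.degree (v i) + 1), Ready L P v k' (i + 1) := by
  obtain ⟨b, hx, hb⟩ := hx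
  have ha := hv.adj i hi
  have hprev : ¬ IsPrev v i (v (i + 1)) := by
    rintro ⟨j, rfl, h⟩
    exact hv.ne j (by omega) h.symm
  obtain ⟨k', hk', b', p', c', m', h⟩ := hx.readMark (p := L.port ha) (by
    intro p'
    constructor
    · rintro ⟨h1, u, hu, rfl, h2⟩
      have := (hP u hu (fun h => h1 ((hb u hu).2 h))).1 h2
      subst this
      rfl
    · rintro rfl
      exact ⟨fun h => hprev ((hb _ ha).1 h), _, ha, rfl, (hP _ ha hprev).2 rfl⟩) (L.port_lt ha)
  have h' := h.step ha rfl
  exact ⟨k' + 1, by omega, ready_of_adj ha (by simpa [update] using h')⟩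

theorem Geodesic.marks (hv : Geodesic G D v) {k a e T : ℕ} (hae : a ≤ e) (he : e ≤ D)
    (hx : Ready L P v k a) (hT : ∀ i, a ≤ i → i < e → G.degree (v i) ≤ T)
    (hP : ∀ i u, a ≤ i → i < e → G.Adj (v i) u → ¬ IsPrev v i u → (u ∈ P ↔ u = v (i + 1))) :
    ∃ k' ≤ k + (e - a) * (2 * T + 1), Ready L P v k' e := by
  induction e, hae using Nat.le_induction with
  | base => exact ⟨k, by simp, hx⟩
  | succ e hae ih =>
    obtain ⟨k', hk', h⟩ := ih (by omega) (fun i h1 h2 => hT i h1 (by omega))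
      (fun i u h1 h2 => hP i u h1 (by omega))
    obtain ⟨k'', hk'', h'⟩ := hv.mark (by omega) h (hP e · hae (by omega))
    refine ⟨k'', ?_, h'⟩
    have := hT e hae (by omega)
    rw [show e + 1 - a = e - a + 1 by omega, add_mul]
    omega

/-- The agent reads a number and follows it as a route of three moves. -/
theorem Geodesic.decode (hv : Geodesic G D v) {d p : ℕ → ℕ} (hd : ∀ i, d i = G.degree (v i))
    (hp : ∀ i, p i = L.portTo (v i) (v (i + 1))) (hd0 : ∀ i, 0 < d i)
    {k e r K : ℕ} (he : e < D) (hx : Ready L P v k e) {S : Finset ℕ}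
    (hS : ∀ q ∈ S, ∃ (u : V) (h : G.Adj (v e) u), L.port h = q ∧ ¬ IsPrev v e u)
    (hP : ∀ (u : V) (h : G.Adj (v e) u), ¬ IsPrev v e u → (u ∈ P ↔ L.port h ∈ S))
    {n : ℕ → ℕ} (hn : n 0 = 0) (hnr : n r = route d p e 3)
    (hD : ∀ q < r, Digit (S ∩ block q).card (n q) (n (q + 1)))
    (hr : (S ∩ block r).card = 3) (hrK : r < K) :
    ∃ k' ≤ k + (2 * (blockSize * K) + 3), (∃ x, At L P (v 0) k' (v D) x) ∨
      (e + 3 ≤ D ∧ Ready L P v k' (e + 3)) := by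
  obtain ⟨b, hx, hb⟩ := hx
  obtain ⟨k', hk', b', p', c', m', h⟩ := hx.readNumber (S := S) (by
    intro q
    constructor
    · rintro ⟨h1, u, hu, rfl, h2⟩
      exact (hP u hu fun h => h1 ((hb u hu).2 h)).1 h2
    · intro hq
      obtain ⟨u, hu, rfl, h1⟩ := hS q hq
      exact ⟨fun h => h1 ((hb u hu).1 h), u, hu, rfl, (hP u hu h1).2 hq⟩) hn hD hr
  have hpd : p e < d e := by
    rw [hp, hd, L.portTo_eq (hv.adj e he)]
    exact L.port_lt _
  have hdiv : n r / G.degree (v e) = route d p (e + 1) 2 := by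
    rw [hnr, ← hd, route, Nat.add_mul_div_left _ _ (by omega), Nat.div_eq_of_lt hpd, zero_add]
  have hmod : n r % G.degree (v e) = p e := by
    rw [hnr, ← hd, route, Nat.add_mul_mod_self_left, Nat.mod_eq_of_lt hpd]
  rw [hdiv, hmod] at h
  obtain ⟨k'', hk'', h'⟩ := hv.follow hd hp hd0 he h
  refine ⟨k'', ?_, h'⟩
  simp only [blockSize] at *
  omega

end Following

/-! ### Free ports -/

section Free

variable {V : Type u} {G : SimpleGraph V} [G.LocallyFinite] {v : ℕ → V} {D : ℕ}

/-- Near a node of large degree, some node has many neighbours that no earlier node sees. -/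
theorem Geodesic.exists_free (hv : Geodesic G D v) (L : PortLabeling G) {a J n : ℕ} (haJ : a ≤ J)
    (hJD : J < D) (hJ : 3 * n ≤ G.degree (v J))
    (hlow : ∀ i, a ≤ i → i < J → G.degree (v i) < 3 * n) :
    ∃ e, a ≤ e ∧ e ≤ J ∧ ∃ F : Finset ℕ, n ≤ F.card + 1 ∧ ∀ p ∈ F, p < 3 * n ∧
      ∃ (u : V) (h : G.Adj (v e) u), L.port h = p ∧ ¬ IsPrev v e u ∧
        ∀ i, a ≤ i → i < e → ¬ G.Adj (v i) u := by
  classical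
  have hex : ∀ p, ∃ u, p < G.degree (v J) → ∃ h : G.Adj (v J) u, L.port h = p := by
    intro p
    by_cases hp : p < G.degree (v J)
    · obtain ⟨u, h⟩ := L.exists_port hp
      exact ⟨u, fun _ => h⟩
    · exact ⟨v J, fun h => absurd h hp⟩
  choose nb hnb using hex
  have hfirst : ∀ p, ∃ i, p < G.degree (v J) → a ≤ i ∧ i ≤ J ∧ G.Adj (v i) (nb p) ∧
      ∀ i', a ≤ i' → i' < i → ¬ G.Adj (v i') (nb p) := by
    intro p
    by_cases hp : p < G.degree (v J)
    · have h : ∃ i, a ≤ i ∧ G.Adj (v i) (nb p) := ⟨J, haJ, (hnb p hp).1⟩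
      exact ⟨Nat.find h, fun _ => ⟨(Nat.find_spec h).1, Nat.find_min' h ⟨haJ, (hnb p hp).1⟩,
        (Nat.find_spec h).2, fun i' h1 h2 h3 => Nat.find_min h h2 ⟨h1, h3⟩⟩⟩
    · exact ⟨0, fun h => absurd h hp⟩
  choose f hf using hfirst
  have hlt : ∀ {p}, p ∈ Finset.range (3 * n) → p < G.degree (v J) := fun h =>
    (Finset.mem_range.1 h).trans_le hJ
  rcases Nat.eq_zero_or_pos n with rfl | hn
  · exact ⟨a, le_rfl, haJ, ∅, by simp, by simp⟩
  -- Only the last three nodes up to `v J` can share a neighbour with it, so the pigeonhole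
  -- principle gives a fibre of size at least `n`.
  have hmaps : ∀ p ∈ Finset.range (3 * n), f p ∈ Finset.Icc (J - 2) J := by
    intro p hp
    obtain ⟨h1, h2, h3, -⟩ := hf p (hlt hp)
    refine Finset.mem_Icc.2 ⟨?_, h2⟩
    by_contra h
    exact hv.not_common (f p) J (nb p) (by omega) hJD.le h3 (hnb p (hlt hp)).1
  obtain ⟨e, -, he⟩ := Finset.exists_le_card_fiber_of_mul_le_card_of_maps_to (n := n) hmaps
    ⟨J, by simp⟩ (by
      rw [Finset.card_range, Nat.card_Icc]
      exact Nat.mul_le_mul_right _ (by omega))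
  set R := {p ∈ Finset.range (3 * n) | f p = e} with hR
  have hRm : ∀ p ∈ R, p < 3 * n ∧ a ≤ e ∧ e ≤ J ∧ (∃ h : G.Adj (v J) (nb p), L.port h = p) ∧
      G.Adj (v e) (nb p) ∧ ∀ i', a ≤ i' → i' < e → ¬ G.Adj (v i') (nb p) := by
    intro p hp
    obtain ⟨h1, h2⟩ := Finset.mem_filter.1 hp
    obtain ⟨h3, h4, h5, h6⟩ := hf p (hlt h1)
    rw [h2] at h3 h4 h5 h6
    exact ⟨Finset.mem_range.1 h1, h3, h4, hnb p (hlt h1), h5, h6⟩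
  obtain ⟨p₀, hp₀⟩ : R.Nonempty := Finset.card_pos.1 (by omega)
  obtain ⟨-, hae, heJ, -⟩ := hRm p₀ hp₀
  have hinj : Set.InjOn (fun p => L.portTo (v e) (nb p)) R := by
    intro p hp q hq h
    obtain ⟨-, -, -, ⟨h1, h1'⟩, h2, -⟩ := hRm p hp
    obtain ⟨-, -, -, ⟨h3, h3'⟩, h4, -⟩ := hRm q hq
    simp only [L.portTo_eq h2, L.portTo_eq h4] at h
    have := L.port_injective h2 h4 h
    rw [← h1', ← h3']
    congr 1
  -- The port of arrival is unusable, which costs one element. For `e = 0` the erased port is the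
  -- default `0`, which is harmless.
  refine ⟨e, hae, heJ, (R.image fun p => L.portTo (v e) (nb p)).erase
    (L.portTo (v e) (v (e - 1))), ?_, ?_⟩
  · have h1 := Finset.card_image_of_injOn hinj
    have h2 := Finset.pred_card_le_card_erase (s := R.image fun p => L.portTo (v e) (nb p))
      (a := L.portTo (v e) (v (e - 1)))
    omega
  · intro q hq
    obtain ⟨hne, hq⟩ := Finset.mem_erase.1 hq
    obtain ⟨p, hp, rfl⟩ := Finset.mem_image.1 hq
    obtain ⟨hp3, -, -, ⟨h1, h1'⟩, h2, h3⟩ := hRm p hp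
    refine ⟨?_, nb p, h2, (L.portTo_eq h2).symm, ?_, h3⟩
    · simp only [L.portTo_eq h2]
      -- Ports stay below `3 * n`: at `v J` by the choice of the neighbours, before it because all
      -- degrees there are small.
      rcases Nat.eq_or_lt_of_le heJ with rfl | h
      · exact h1'.symm ▸ hp3
      · exact (L.port_lt h2).trans (hlow e hae h)
    · rintro ⟨j, rfl, h⟩
      apply hne
      simp only [h, Nat.add_sub_cancel]

end Free

/-! ### Placing the pebbles -/

section Oracle

variable {V : Type u} [DecidableEq V] {G : SimpleGraph V} [G.LocallyFinite] {v : ℕ → V} {D : ℕ}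

/-- Pebbles for the part of the path from index `a` on guide the agent to its end, whatever
pebbles are placed elsewhere. -/
theorem Geodesic.exists_pebbles (hv : Geodesic G D v) (L : PortLabeling G) {M : ℕ}
    (hd0 : ∀ i, 0 < G.degree (v i))
    (hM : ∀ i, (route (fun i => G.degree (v i)) (fun i => L.portTo (v i) (v (i + 1))) i 3).size ≤ M)
    {T : ℕ} (hT : T = blockSize * (5 * M + 1)) (a : ℕ) (ha : a ≤ D) :
    ∃ S : Finset V, S.card ≤ (D - a) * (T + 1) ∧
      (∀ u ∈ S, ∃ j, a ≤ j ∧ j < D ∧ G.Adj (v j) u) ∧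
      ∀ P : Finset V, (∀ i u, a ≤ i → i < D → G.Adj (v i) u → ¬ IsPrev v a u → (u ∈ P ↔ u ∈ S)) →
        ∀ k, Ready L P v k a →
          ∃ k' ≤ k + (D - a) * (2 * T + 3), ∃ x, At L P (v 0) k' (v D) x := by
  induction hm : D - a using Nat.strong_induction_on generalizing a with
  | _ m ih =>
  subst hm
  have hself : ∀ {i j}, i ≤ D → j ≤ D → G.Adj (v i) (v j) → j = i + 1 ∨ IsPrev v i (v j) := by
    intro i j hi hj h
    rcases lt_trichotomy i j with h1 | rfl | h1
    · by_contra h2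
      exact hv.not_adj i j (by omega) hj h
    · exact absurd h (G.loopless.irrefl _)
    · by_cases h2 : j + 1 = i
      · exact Or.inr ⟨j, h2, rfl⟩
      · exact absurd h.symm (hv.not_adj j i (by omega) hi)
  have hback : ∀ {i u}, a ≤ i → i ≤ D → G.Adj (v i) u → IsPrev v a u → IsPrev v i u := by
    rintro i _ hai hi h ⟨j, rfl, rfl⟩
    by_cases h2 : j + 1 = i
    · exact ⟨j, h2, rfl⟩
    · exact absurd h.symm (hv.not_adj j i (by omega) hi)
  by_cases hlarge : ∃ J, a ≤ J ∧ J < D ∧ T ≤ G.degree (v J)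
  · obtain ⟨haJ, hJD, hJT⟩ := Nat.find_spec hlarge
    have hmin : ∀ i, a ≤ i → i < Nat.find hlarge → G.degree (v i) < T := by
      intro i h1 h2
      by_contra h3
      exact Nat.find_min hlarge h2 ⟨h1, by omega, by omega⟩
    generalize Nat.find hlarge = J at haJ hJD hJT hmin
    have hT3 : T = 3 * (4 * (5 * M + 1)) := by rw [hT, blockSize]; ring
    obtain ⟨e, hae, heJ, F, hFc, hF⟩ := hv.exists_free L (n := 4 * (5 * M + 1)) haJ hJD
      (by omega) (fun i h1 h2 => by rw [← hT3]; exact hmin i h1 h2)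
    -- With `K = 5 * M + 1` blocks and at least `4 * K - 1` free ports, the number `U` of usable
    -- blocks satisfies `10 * U ≥ 2 * K - 1 = 10 * M + 1`, so `U > M`: room for the digits and the
    -- terminator.
    have huse := card_usable F (5 * M + 1) fun p hp => by
      have := (hF p hp).1
      omega
    obtain ⟨C, hCF, r, hr, n, hn0, hnr, hdig, hend⟩ := exists_codeword F (5 * M + 1)
      (route (fun i => G.degree (v i)) (fun i => L.portTo (v i) (v (i + 1))) e 3) (by
        have := hM e
        omega)
    have heD : e < D := by omega
    have hnode : ∀ p, ∃ u, p ∈ C → ∃ h : G.Adj (v e) u, L.port h = p ∧ ¬ IsPrev v e u ∧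
        ∀ i, a ≤ i → i < e → ¬ G.Adj (v i) u := by
      intro p
      by_cases hp : p ∈ C
      · obtain ⟨-, u, hu⟩ := hF p (hCF hp)
        exact ⟨u, fun _ => hu⟩
      · exact ⟨v e, fun h => absurd h hp⟩
    choose nd hnd using hnode
    -- If fewer than three moves remain, the route passes the treasure and no further pebbles are
    -- needed.
    obtain ⟨S', hSc, hSl, hS'⟩ : ∃ S : Finset V, S.card ≤ (D - (e + 3)) * (T + 1) ∧
      (∀ u ∈ S, ∃ j, e + 3 ≤ j ∧ j < D ∧ G.Adj (v j) u) ∧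
      (e + 3 ≤ D → ∀ P : Finset V, (∀ i u, e + 3 ≤ i → i < D → G.Adj (v i) u →
        ¬ IsPrev v (e + 3) u → (u ∈ P ↔ u ∈ S)) → ∀ k, Ready L P v k (e + 3) →
          ∃ k' ≤ k + (D - (e + 3)) * (2 * T + 3), ∃ x, At L P (v 0) k' (v D) x) := by
      by_cases h3 : e + 3 ≤ D
      · obtain ⟨S, h4, h5, h6⟩ := ih _ (by omega) (e + 3) h3 rfl
        exact ⟨S, h4, h5, fun _ => h6⟩
      · exact ⟨∅, by simp, by simp, fun h => absurd h h3⟩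
    have hmem : ∀ u, u ∈ (Finset.Ioc a e).image v ∪ (C.image nd ∪ S') ↔
        (∃ j, a < j ∧ j ≤ e ∧ v j = u) ∨ (∃ p ∈ C, nd p = u) ∨ u ∈ S' := by
      intro u
      simp [and_assoc]
    refine ⟨(Finset.Ioc a e).image v ∪ (C.image nd ∪ S'), ?_, ?_, ?_⟩
    · have h1 : ((Finset.Ioc a e).image v).card ≤ e - a :=
        Finset.card_image_le.trans (by simp)
      have h2 : (C.image nd).card ≤ T := by
        refine Finset.card_image_le.trans ?_
        have h : C ⊆ Finset.range T := fun p hp => by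
          have := (hF p (hCF hp)).1
          exact Finset.mem_range.2 (by omega)
        simpa using Finset.card_le_card h
      have h3 : ((e - a) + 1 + (D - (e + 3))) * (T + 1) ≤ (D - a) * (T + 1) :=
        Nat.mul_le_mul_right _ (by omega)
      have h4 : (e - a) * 1 ≤ (e - a) * (T + 1) := Nat.mul_le_mul_left _ (by omega)
      have h5 := Finset.card_union_le ((Finset.Ioc a e).image v) (C.image nd ∪ S')
      have h6 := Finset.card_union_le (C.image nd) S'
      rw [add_mul, add_mul] at h3
      omega
    · intro u hu
      rcases (hmem u).1 hu with ⟨j, h1, h2, rfl⟩ | ⟨p, hp, rfl⟩ | hu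
      · obtain ⟨j, rfl⟩ : ∃ i, j = i + 1 := ⟨j - 1, by omega⟩
        exact ⟨j, by omega, by omega, hv.adj j (by omega)⟩
      · exact ⟨e, hae, heD, (hnd p hp).1⟩
      · obtain ⟨j, h1, h2, h3⟩ := hSl u hu
        exact ⟨j, by omega, h2, h3⟩
    · intro P hP k hk
      -- No interference up to `v e`: a mark is seen only from its two path neighbours, and from the
      -- later one it is the ignored predecessor; the codeword is hidden from earlier nodes; the
      -- pebbles of `S'` are too far along.
      have hP' : ∀ i u, a ≤ i → i ≤ e → G.Adj (v i) u → ¬ IsPrev v i u →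
          (u ∈ P ↔ (i < e ∧ u = v (i + 1)) ∨ ∃ p ∈ C, i = e ∧ nd p = u) := by
        intro i u h1 h2 h3 h4
        rw [hP i u h1 (by omega) h3 (fun h => h4 (hback h1 (by omega) h3 h)), hmem]
        constructor
        · rintro (⟨j, h5, h6, rfl⟩ | ⟨p, hp, rfl⟩ | hu)
          · rcases hself (by omega) (by omega) h3 with rfl | h7
            · exact Or.inl ⟨by omega, rfl⟩
            · exact absurd h7 h4
          · rcases Nat.eq_or_lt_of_le h2 with rfl | h5
            · exact Or.inr ⟨p, hp, rfl, rfl⟩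
            · exact absurd h3 ((hnd p hp).2.2.2 i h1 h5)
          · obtain ⟨j, h5, h6, h7⟩ := hSl u hu
            exact absurd h7 (hv.not_common i j u (by omega) (by omega) h3)
        · rintro (⟨h5, rfl⟩ | ⟨p, hp, -, h5⟩)
          · exact Or.inl ⟨i + 1, by omega, by omega, rfl⟩
          · exact Or.inr (Or.inl ⟨p, hp, h5⟩)
      obtain ⟨k₁, hk₁, hx₁⟩ := hv.marks (T := T) hae heD.le hk
        (fun i h1 h2 => (hmin i h1 (by omega)).le) (fun i u h1 h2 h3 h4 => by
          rw [hP' i u h1 h2.le h3 h4]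
          constructor
          · rintro (⟨-, h⟩ | ⟨p, hp, h, -⟩)
            · exact h
            · omega
          · exact fun h => Or.inl ⟨h2, h⟩)
      obtain ⟨k₂, hk₂, hx₂⟩ := hv.decode (fun _ => rfl) (fun _ => rfl) hd0 heD hx₁ (S := C)
        (fun q hq => by
          obtain ⟨h1, h2, h3, -⟩ := hnd q hq
          exact ⟨_, h1, h2, h3⟩)
        (fun u h h' => by
          rw [hP' e u hae le_rfl h h']
          constructor
          · rintro (⟨h1, -⟩ | ⟨p, hp, -, rfl⟩)
            · omega
            · obtain ⟨h1, h2, -⟩ := hnd p hp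
              exact h2.symm ▸ hp
          · intro hp
            obtain ⟨h1, h2, -⟩ := hnd _ hp
            exact Or.inr ⟨_, hp, rfl, L.port_injective h1 h h2⟩)
        hn0 hnr hdig hend hr
      rw [← hT] at hk₂
      have h3 : ((e - a) + 1 + (D - (e + 3))) * (2 * T + 3) ≤ (D - a) * (2 * T + 3) :=
        Nat.mul_le_mul_right _ (by omega)
      have h4 : (e - a) * (2 * T + 1) ≤ (e - a) * (2 * T + 3) := Nat.mul_le_mul_left _ (by omega)
      rw [add_mul, add_mul] at h3
      rcases hx₂ with ⟨x, hx⟩ | ⟨h5, hx⟩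
      · exact ⟨k₂, by omega, x, hx⟩
      · obtain ⟨k₃, hk₃, hx₃⟩ := hS' h5 P (fun i u h6 h7 h8 _ => by
          rw [hP i u (by omega) h7 h8 (by
            rintro ⟨j, rfl, rfl⟩
            exact hv.not_adj j i (by omega) h7.le h8.symm), hmem]
          constructor
          · rintro (⟨j, h9, h10, rfl⟩ | ⟨p, hp, rfl⟩ | hu)
            · exact absurd h8.symm (hv.not_adj j i (by omega) h7.le)
            · exact absurd h8 (hv.not_common e i _ (by omega) h7.le (hnd p hp).1)
            · exact hu
          · exact fun hu => Or.inr (Or.inr hu)) k₂ hx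
        exact ⟨k₃, by omega, hx₃⟩
  · have hmem : ∀ u, u ∈ (Finset.Ioc a D).image v ↔ ∃ j, a < j ∧ j ≤ D ∧ v j = u := by
      intro u
      simp [and_assoc]
    refine ⟨(Finset.Ioc a D).image v, ?_, ?_, ?_⟩
    · calc ((Finset.Ioc a D).image v).card ≤ (D - a) * 1 :=
            Finset.card_image_le.trans (by simp)
        _ ≤ (D - a) * (T + 1) := Nat.mul_le_mul_left _ (by omega)
    · intro u hu
      obtain ⟨j, h1, h2, rfl⟩ := (hmem u).1 hu
      obtain ⟨j, rfl⟩ : ∃ i, j = i + 1 := ⟨j - 1, by omega⟩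
      exact ⟨j, by omega, by omega, hv.adj j (by omega)⟩
    · intro P hP k hk
      obtain ⟨k', hk', b, hx, -⟩ := hv.marks (T := T) ha le_rfl hk
        (fun i h1 h2 => by
          by_contra h3
          exact hlarge ⟨i, h1, h2, by omega⟩)
        (fun i u h1 h2 h3 h4 => by
          rw [hP i u h1 h2 h3 (fun h => h4 (hback h1 h2.le h3 h)), hmem]
          constructor
          · rintro ⟨j, h5, h6, rfl⟩
            rcases hself h2.le h6 h3 with rfl | h7
            · rfl
            · exact absurd h7 h4
          · rintro rfl
            exact ⟨i + 1, by omega, by omega, rfl⟩)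
      have h4 : (D - a) * (2 * T + 1) ≤ (D - a) * (2 * T + 3) := Nat.mul_le_mul_left _ (by omega)
      exact ⟨k', by omega, _, hx⟩

/-- Pebbles that guide the agent from `s` to `t`, in terms of a bound on the degrees. -/
theorem exists_pebbles_of_degree_lt (L : PortLabeling G) {s t : V} (hst : G.Reachable s t) {l : ℕ}
    (hl : ∀ u, G.degree u < 2 ^ l) :
    ∃ P : Finset V, P.card ≤ G.dist s t * (180 * l + 193) ∧
      ∃ k ≤ G.dist s t * (360 * l + 387), ReachesAfter L P agent s t k := by
  obtain ⟨w, hw⟩ := hst.exists_walk_length_eq_dist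
  have hv := Geodesic.of_walk w hw
  rcases Nat.eq_zero_or_pos w.length with h0 | hpos
  · obtain rfl : s = t := SimpleGraph.Walk.eq_of_length_eq_zero h0
    exact ⟨∅, by simp, 0, by simp, At.zero.reaches⟩
  -- Routes may run past the end of the path, where `getVert` stays at `t`, so those degrees must be
  -- positive too.
  have hd0 : ∀ i, 0 < G.degree (w.getVert i) := by
    intro i
    rw [SimpleGraph.degree_pos_iff_exists_adj]
    rcases lt_or_ge i w.length with hi | hi
    · exact ⟨_, hv.adj i hi⟩
    · rw [w.getVert_of_length_le hi]
      obtain ⟨n, hn⟩ := Nat.exists_eq_succ_of_ne_zero hpos.ne'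
      have h := hv.adj n (by omega)
      rw [w.getVert_of_length_le (by omega : w.length ≤ n + 1)] at h
      exact ⟨_, h.symm⟩
  have hM : ∀ i, (route (fun i => G.degree (w.getVert i))
      (fun i => L.portTo (w.getVert i) (w.getVert (i + 1))) i 3).size ≤ 3 * l + 3 := by
    intro i
    rw [Nat.size_le]
    refine (route_le (m := 2 ^ l - 1) hd0 (fun i => Nat.le_sub_one_of_lt (hl _))
      (fun i => ?_) i 3).trans_lt ?_
    · rw [PortLabeling.portTo]
      split_ifs with h
      · exact Nat.le_sub_one_of_lt ((L.port_lt h).trans (hl _))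
      · exact Nat.zero_le _
    · have : 0 < 2 ^ l := Nat.two_pow_pos l
      calc (2 * (2 ^ l - 1)) ^ 3 < (2 * 2 ^ l) ^ 3 :=
            Nat.pow_lt_pow_left (by omega) (by omega)
        _ = 2 ^ (3 * l + 3) := by rw [← pow_succ', ← pow_mul]; congr 1; ring
  obtain ⟨P, h1, -, h3⟩ := hv.exists_pebbles L hd0 hM rfl 0 (Nat.zero_le _)
  obtain ⟨k, hk, x, hx⟩ := h3 P (fun _ _ _ _ _ _ => Iff.rfl) 0 Ready.zero
  refine ⟨P, h1.trans ?_, k, hk.trans ?_, ?_⟩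
  · rw [hw, Nat.sub_zero, blockSize]
    exact Nat.mul_le_mul_left _ (by omega)
  · rw [hw, Nat.sub_zero, blockSize, zero_add]
    exact Nat.mul_le_mul_left _ (by omega)
  · simpa using hx.reaches

end Oracle

end TreasureHunt

theorem mainTheorem1 :
    ∃ A : TreasureHunt.Strategy, Computable A ∧ ∃ C : ℝ,
      ∀ (V : Type*) [Fintype V] [DecidableEq V] (G : SimpleGraph V) [DecidableRel G.Adj]
        (L : TreasureHunt.PortLabeling G) (s t : V),
        2 ≤ G.maxDegree → G.Reachable s t →
        ∃ pebbles : Finset V,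
          (pebbles.card : ℝ) ≤ C * ((G.dist s t : ℝ) * Real.logb 2 G.maxDegree) ∧
          ∃ n : ℕ, TreasureHunt.ReachesAfter L pebbles A s t n ∧
            (n : ℝ) ≤ C * ((G.dist s t : ℝ) * Real.logb 2 G.maxDegree
              + Real.logb 2 G.maxDegree ^ 3) := by
  -- The constant is 1107 = 360 + 360 + 387: for `x ≥ 1`, `360 * (x + 1) + 387 ≤ 1107 * x`.
  refine ⟨TreasureHunt.agent, TreasureHunt.computable_agent, 1107, ?_⟩
  intro V _ _ G _ L s t hΔ hst
  obtain ⟨P, hP, k, hk, hr⟩ := TreasureHunt.exists_pebbles_of_degree_lt L hst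
    (l := Nat.log 2 G.maxDegree + 1)
    (fun u => (G.degree_le_maxDegree u).trans_lt (Nat.lt_pow_succ_log_self one_lt_two _))
  have hlog : (Nat.log 2 G.maxDegree : ℝ) ≤ Real.logb 2 G.maxDegree := by
    exact_mod_cast Real.natLog_le_logb G.maxDegree 2
  have hone : 1 ≤ Real.logb 2 G.maxDegree := by
    rw [Real.le_logb_iff_rpow_le one_lt_two (by positivity)]
    simpa using (by exact_mod_cast hΔ : (2 : ℝ) ≤ G.maxDegree)
  generalize Real.logb 2 G.maxDegree = x at hlog hone
  have hD : (0 : ℝ) ≤ G.dist s t := Nat.cast_nonneg _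
  refine ⟨P, ?_, k, hr, ?_⟩
  · have h : (P.card : ℝ) ≤ G.dist s t * (180 * (Nat.log 2 G.maxDegree + 1) + 193) := by
      exact_mod_cast hP
    have h' : (G.dist s t : ℝ) * (180 * (Nat.log 2 G.maxDegree + 1) + 193) ≤
        G.dist s t * (1107 * x) := mul_le_mul_of_nonneg_left (by linarith) hD
    linarith
  · have h : (k : ℝ) ≤ G.dist s t * (360 * (Nat.log 2 G.maxDegree + 1) + 387) := by
      exact_mod_cast hk
    have h' : (G.dist s t : ℝ) * (360 * (Nat.log 2 G.maxDegree + 1) + 387) ≤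
        G.dist s t * (1107 * x) := mul_le_mul_of_nonneg_left (by linarith) hD
    have h3 : 0 ≤ x ^ 3 := by positivity
    linarith
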